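/- **Setting.** Let $Q^*=\{q_1,\dots,q_M\}$ be a finite benchmark, $(\mathcal F,d_{\mathcal F})$ a (pseudo)metric space of models with a $\sigma$-algebra containing the open sets, $P_f$ a probability measure on $\mathcal F$, and $y:\mathcal F\times 2^{Q^*}\to[0,1]$ a score, measurable in the model. For each $q_j$ the response of $f$ to $q_j$ has a law that depends measurably on $f$; $g$ is a fixed measurable embedding of responses into $\mathbb R^p$, and the embedded response $g(f(q_j))$ has a finite second moment for all $f,j$. Random models $f,f_1,f_2,\dots$ are i.i.d. from $P_f$; given the models, all responses are independent, with $r$ responses per model and query. For $Q\subseteq Q^*$ and a collection of $n$ models let $\bar X_i$ be the matrix with a row for each $q_j\in Q$, namely the average of the $r$ embedded responses of the $i$-th model to $q_j$. *Estimated perspectives* (DKPS representations) $\widehat\psi_i\in\mathbb R^d$ of the collection are any minimizer of $\sum_{i,i'}(\|z_i-z_{i'}\|-D_{ii'})^2$ over $z_1,\dots,z_n\in\mathbb R^d$, with $D_{ii'}=\|\bar X_i-\bar X_{i'}\|_F$ (chosen measurably in the data). *True perspectives* $\psi_i(Q)\in\mathbb R^d$ of the collection are any minimizer of the same expression with every average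 embedded response replaced by its expectation $\mathbb E[g(f_i(q_j))]$. Given $n$ reference models with responses and a target $f$ with responses, estimated perspectives $\widehat\psi,\widehat\psi_1,\dots,\widehat\psi_n$ of the target and the reference models are computed together, and $\hat y_{NN}$ is the average of the scores $y(f_i,Q^*)$ over all $i$ that attain $\min_k\|\widehat\psi_k-\widehat\psi\|_2$. The subset score is $\hat y_Q=y(f,Q)$. For an estimator $\hat y$, $\mathrm{MSE}(\hat y)=\mathbb E[(\hat y-y(f,Q^*))^2]$, where the expectation is over the target $f\sim P_f$ and its responses, given the reference data. A statement about $(n,r)$ and the reference data holds *with high probability* if for every $\eta>0$ there is $N$ such that for every $n>N$ there is $R$ such that for all $r\ge R$ it fails with probability at most $\eta$. **Assumption 1 for $Q$.** There is $\gamma>0$ such that $|y(f,Q^*)-y(f',Q^*)|\le\gamma\|\psi(Q)-\psi'(Q)\|_2$ for all true perspectives $\psi(Q),\psi'(Q)$ of models $f,f'$ in any finite collection. **Assumption 2 for $Q$.** $P_f(\{f':d_{\mathcal F}(f,f')<\delta\})>0$ for all $f\in\mathcal F$, $\delta>0$; and $d_{\mathcal F}$ is appropriate for the perspective space: for every $f$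 and $\varepsilon'>0$ there is $\delta>0$ such that $d_{\mathcal F}(f,f')<\delta$ implies $\|\psi(Q)-\psi'(Q)\|_2<\varepsilon'$ for all true perspectives of $f$ and $f'$ in any finite collection that contains both. **Theorem.** 1. If $Q\subseteq Q^*$ satisfies Assumptions 1 and 2, then for every $\varepsilon>0$, $\mathrm{MSE}(\hat y_{NN})\le\varepsilon$ with high probability. In particular, for $m=|Q|$ and any prescribed failure probability there are $n$ and $r$ for which the bound holds. 2. If moreover $\mathrm{MSE}(\hat y_Q)>0$, then $\hat y_{NN}$ is $Q$-query-efficient relative to $\hat y_Q$ with high probability: $\mathrm{MSE}(\hat y_{NN})\le\mathrm{MSE}(\hat y_Q)$ with high probability. 3. Consequently, if $m<M$ and every $Q$ with $|Q|=m$ satisfies Assumptions 1 and 2 and $\mathrm{MSE}(\hat y_Q)>0$, then $\hat y_{NN}$ is $m$-query-efficient relative to $\hat y_Q$ with high probability (the conclusion of 2 holds for all $Q$ with $|Q|=m$); and if this is so for all $1\le m<M$, then $\hat y_{NN}$ is query-efficient relative to $\hat y_Q$ with high probability (it is $m$-query-efficient for all $1\le m<M$). -/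

import Mathlib

open MeasureTheory ProbabilityTheory

noncomputable section

namespace DKPS

/-- A benchmark of `M` queries (the full query set `Q*` is indexed by `Fin M`), a space `F` of
models with the law `modelLaw` (`P_f`), the response distributions of a model to each query, a
fixed embedding of responses into `ℝ^p`, and a `[0,1]`-valued score of every model on every subset
of the queries. -/
structure Setting (F X : Type*) [MeasurableSpace F] [MeasurableSpace X] (M p : ℕ) where
  modelLaw : Measure F
  modelLaw_prob : IsProbabilityMeasure modelLaw
  /-- `response j f` is the law of the (random) response of the model `f` to the query `j`. -/
  response : Fin M → Kernel F X
  response_markov : ∀ j, IsMarkovKernel (response j)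
  embed : X → EuclideanSpace ℝ (Fin p)
  embed_measurable : Measurable embed
  score : F → Finset (Fin M) → ℝ
  score_mem : ∀ f Q, score f Q ∈ Set.Icc (0 : ℝ) 1
  score_measurable : ∀ Q, Measurable fun f => score f Q

attribute [instance] Setting.modelLaw_prob Setting.response_markov

/-- A model together with `r` cached responses to each of the `M` queries. -/
abbrev Draw (F X : Type*) (M r : ℕ) : Type _ := F × (Fin M × Fin r → X)

section Multidimensional

variable {ι : Type*} [Fintype ι] {d : ℕ}

/-- The raw stress of a configuration `z` of points of `ℝ^d` for the dissimilarities `D`. -/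
def stress (D : ι → ι → ℝ) (z : ι → EuclideanSpace ℝ (Fin d)) : ℝ :=
  ∑ i, ∑ i', (‖z i - z i'‖ - D i i') ^ 2

/-- `z` is a solution of the multidimensional scaling problem for `D` in `ℝ^d`. -/
def IsStressMinimizer (D : ι → ι → ℝ) (z : ι → EuclideanSpace ℝ (Fin d)) : Prop :=
  ∀ z' : ι → EuclideanSpace ℝ (Fin d), stress D z ≤ stress D z'

end Multidimensional

/-- Frobenius distance between two matrices whose rows are indexed by the queries, restricted to
the rows in `Q`. -/
def frobDist {M p : ℕ} (Q : Finset (Fin M)) (A B : Fin M → EuclideanSpace ℝ (Fin p)) : ℝ :=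
  Real.sqrt (∑ j ∈ Q, ‖A j - B j‖ ^ 2)

/-- Nearest-neighbour regression: index `0` is the target, the indices `i.succ` are the reference
models with scores `y i`; the scores of all nearest neighbours are averaged. -/
def nnPredict {n d : ℕ} (z : Fin (n + 1) → EuclideanSpace ℝ (Fin d)) (y : Fin n → ℝ) : ℝ :=
  open Classical in
  (∑ i : Fin n, if ‖z i.succ - z 0‖ = ⨅ k : Fin n, ‖z k.succ - z 0‖ then y i else 0) /
    (∑ i : Fin n, if ‖z i.succ - z 0‖ = ⨅ k : Fin n, ‖z k.succ - z 0‖ then 1 else 0)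

namespace Setting

variable {F X : Type*} [MeasurableSpace F] [MeasurableSpace X] {M p : ℕ} (S : Setting F X M p)

/-- Given a model, its `r` responses to each query are independent, those to query `j` having the
law `response j f`. -/
def responseKernel (r : ℕ) : Kernel F (Fin M × Fin r → X) where
  toFun f := Measure.pi fun jk : Fin M × Fin r => S.response jk.1 f
  measurable' := by
    refine Measurable.measure_of_isPiSystem_of_isProbabilityMeasure generateFrom_pi.symm
      isPiSystem_pi ?_
    rintro _ ⟨s, hs, rfl⟩
    simp only [Measure.pi_pi]
    exact Finset.measurable_prod _ fun jk _ =>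
      (S.response jk.1).measurable_coe (hs jk (Set.mem_univ jk))

/-- The joint law of a random model and its responses. -/
def drawLaw (r : ℕ) : Measure (Draw F X M r) := S.modelLaw ⊗ₘ S.responseKernel r

/-- The law of `n` independent reference models with their responses. -/
def trainLaw (n r : ℕ) : Measure (Fin n → Draw F X M r) := Measure.pi fun _ => S.drawLaw r

/-- Average embedded responses of a model, one row for each query. -/
def meanResponse {r : ℕ} (x : Draw F X M r) : Fin M → EuclideanSpace ℝ (Fin p) :=
  fun j => (r : ℝ)⁻¹ • ∑ k : Fin r, S.embed (x.2 (j, k))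

/-- Expected embedded responses of a model, one row for each query. -/
def expResponse (f : F) : Fin M → EuclideanSpace ℝ (Fin p) :=
  fun j => ∫ x, S.embed x ∂(S.response j f)

/-- The estimated dissimilarities of a finite collection, from the responses to `Q`. -/
def estDist {ι : Type*} {r : ℕ} (Q : Finset (Fin M)) (x : ι → Draw F X M r) : ι → ι → ℝ :=
  fun i i' => frobDist Q (S.meanResponse (x i)) (S.meanResponse (x i'))

/-- The population dissimilarities of a finite collection of models under `Q`. -/
def popDist {ι : Type*} (Q : Finset (Fin M)) (c : ι → F) : ι → ι → ℝ :=
  fun i i' => frobDist Q (S.expResponse (c i)) (S.expResponse (c i'))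

/-- `ψ` are true `d`-dimensional perspectives of the collection `c` under `Q`: a solution of the
scaling problem with every average response replaced by its expectation. -/
def IsTruePerspective {d n : ℕ} (Q : Finset (Fin M)) (c : Fin n → F)
    (ψ : Fin n → EuclideanSpace ℝ (Fin d)) : Prop :=
  IsStressMinimizer (S.popDist Q c) ψ

/-- `psiHat` computes, measurably in the data, estimated `d`-dimensional perspectives under every
query set; any solution of the scaling problem may be chosen. -/
def IsDKPS {d : ℕ} (psiHat : Finset (Fin M) → ∀ n r : ℕ,
    (Fin n → Draw F X M r) → Fin n → EuclideanSpace ℝ (Fin d)) : Prop :=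
  ∀ Q n r, Measurable (psiHat Q n r) ∧ ∀ x, IsStressMinimizer (S.estDist Q x) (psiHat Q n r x)

/-- Every embedded response distribution has a finite second moment. -/
def FiniteSecondMoment : Prop := ∀ f j, MemLp S.embed 2 (S.response j f)

/-- The full benchmark score is `γ`-Lipschitz on the `d`-dimensional perspective space induced by
`Q`, for some `γ > 0`. -/
def LipschitzScore (d : ℕ) (Q : Finset (Fin M)) : Prop :=
  ∃ γ : ℝ, 0 < γ ∧ ∀ (n : ℕ) (c : Fin n → F) (ψ : Fin n → EuclideanSpace ℝ (Fin d)),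
    S.IsTruePerspective Q c ψ → ∀ i i',
      |S.score (c i) Finset.univ - S.score (c i') Finset.univ| ≤ γ * ‖ψ i - ψ i'‖

/-- Every ball of the model space has positive mass. -/
def FullSupport [PseudoMetricSpace F] : Prop :=
  ∀ (f : F) (δ : ℝ), 0 < δ → ∃ ε : ℝ, 0 < ε ∧ ε ≤ S.modelLaw.real (Metric.ball f δ)

/-- The distance on models is appropriate for the perspective space induced by `Q`: models close
to `f` have true perspectives close to that of `f`. -/
def PerspectiveContinuous [PseudoMetricSpace F] (d : ℕ) (Q : Finset (Fin M)) : Prop :=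
  ∀ (f : F) (ε : ℝ), 0 < ε → ∃ δ : ℝ, 0 < δ ∧ ∀ f' : F, dist f f' < δ →
    ∀ (n : ℕ) (c : Fin n → F) (ψ : Fin n → EuclideanSpace ℝ (Fin d)),
      S.IsTruePerspective Q c ψ → ∀ i i', c i = f → c i' = f' → ‖ψ i - ψ i'‖ < ε

end Setting

/-- A sequence of decision functions (for every number `n` of reference models and `r` of
responses): the prediction for a target from the reference data and the target's data. -/
abbrev Predictor (F X : Type*) (M : ℕ) : Type _ :=
  ∀ n r : ℕ, (Fin n → Draw F X M r) → Draw F X M r → ℝ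

def sqLoss (a b : ℝ) : ℝ := (a - b) ^ 2

namespace Setting

variable {F X : Type*} [MeasurableSpace F] [MeasurableSpace X] {M p : ℕ} (S : Setting F X M p)

/-- The expected loss of a predictor over a random target, given the reference data `s`. -/
def risk (ℓ : ℝ → ℝ → ℝ) (h : Predictor F X M) {n r : ℕ} (s : Fin n → Draw F X M r) : ℝ :=
  ∫ t, ℓ (h n r s t) (S.score t.1 Finset.univ) ∂(S.drawLaw r)

/-- The subset-score estimator, which does not use the reference data. -/
def subsetPredictor (Q : Finset (Fin M)) : Predictor F X M := fun _ _ _ t => S.score t.1 Q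

/-- Nearest-neighbour regression on estimated perspectives, which are computed for the target
(index `0`) and the reference models together. -/
def nnPredictor {d : ℕ} (psiHat : Finset (Fin M) → ∀ n r : ℕ,
    (Fin n → Draw F X M r) → Fin n → EuclideanSpace ℝ (Fin d)) (Q : Finset (Fin M)) :
    Predictor F X M :=
  fun n r s t => nnPredict (psiHat Q (n + 1) r (Fin.cons t s))
    fun i => S.score (s i).1 Finset.univ

/-- With high probability over the reference data, for all large `n` and all `r` that are large
depending on `n`: the failure probability of `E` is eventually below every `η > 0`. -/
def WithHighProbability (E : ∀ n r : ℕ, (Fin n → Draw F X M r) → Prop) : Prop :=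
  ∀ η : ℝ, 0 < η → ∃ N : ℕ, ∀ n, N < n → ∃ R : ℕ, ∀ r, R ≤ r →
    (S.trainLaw n r).real {s | ¬ E n r s} ≤ η

/-- With high probability, `h` is query-efficient relative to `h'` for a fixed query set. -/
def QEfficient (ℓ : ℝ → ℝ → ℝ) (h h' : Predictor F X M) : Prop :=
  S.WithHighProbability fun _ _ s => S.risk ℓ h s ≤ S.risk ℓ h' s

/-- The same for all query sets of size `m`. -/
def MEfficient (ℓ : ℝ → ℝ → ℝ) (m : ℕ) (h h' : Finset (Fin M) → Predictor F X M) : Prop :=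
  ∀ Q, Q.card = m → S.QEfficient ℓ (h Q) (h' Q)

/-- The same for all query budgets `1 ≤ m < M`. -/
def QueryEfficient (ℓ : ℝ → ℝ → ℝ) (h h' : Finset (Fin M) → Predictor F X M) : Prop :=
  ∀ m, 1 ≤ m → m < M → S.MEfficient ℓ m h h'

/-- The mean squared error of the subset score over the model distribution. -/
def subsetMSE (Q : Finset (Fin M)) : ℝ :=
  ∫ f, (S.score f Q - S.score f Finset.univ) ^ 2 ∂S.modelLaw

end Setting

end DKPS

end

/-! Scaling solutions are neither unique nor continuous in the dissimilarities, so convergence of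
estimated to true perspectives is not available. What survives is upper semicontinuity: by
compactness and translation invariance, the dissimilarities having some solution in a closed,
translation-invariant set form a closed set (`isClosed_exists_isStressMinimizer`). Hence "no
solution isolates the target" and "no solution puts this reference near the target" are open
conditions.

Fix a collection in which every solution of the population problem puts a reference within ε of the
target. A reference whose score is off by more than γε is, by the Lipschitz assumption, never within
ε. Both facts are open, so they persist once the sample means are close to their expectations; then
every nearest neighbour, under any choice of solution, has a score within γε of the target's
(`exists_forall_notMem_misleadingData`).

Two limits remain. As n grows, isolated collections become improbable: all references would have to
avoid a ball of positive mass around the target. For fixed n, the law of large numbers removes the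
sampling error as r grows. Neither rate is uniform, so each limit is integrated by dominated
convergence, and r is chosen after n. Markov's inequality turns the joint probability of misleading
data into a bound on the risk given the reference data. -/

open Filter Topology

namespace DKPS

/-! ### Stability of multidimensional scaling. -/

section Multidimensional

variable {n d : ℕ}

theorem continuous_stress :
    Continuous fun q : (Fin n → Fin n → ℝ) × (Fin n → EuclideanSpace ℝ (Fin d)) =>
      stress q.1 q.2 := by
  unfold stress
  fun_prop

theorem stress_sub_const (D : Fin n → Fin n → ℝ) (z : Fin n → EuclideanSpace ℝ (Fin d))
    (v : EuclideanSpace ℝ (Fin d)) : stress D (fun i => z i - v) = stress D z := by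
  simp [stress]

theorem IsStressMinimizer.sub_const {D : Fin n → Fin n → ℝ}
    {z : Fin n → EuclideanSpace ℝ (Fin d)} (hz : IsStressMinimizer D z)
    (v : EuclideanSpace ℝ (Fin d)) : IsStressMinimizer D fun i => z i - v := fun z' => by
  rw [stress_sub_const]
  exact hz z'

/-- The distances in a solution of the scaling problem are controlled by the dissimilarities. -/
theorem IsStressMinimizer.norm_sub_le {D : Fin n → Fin n → ℝ}
    {z : Fin n → EuclideanSpace ℝ (Fin d)} (hz : IsStressMinimizer D z) (i i' : Fin n) :
    ‖z i - z i'‖ ≤ D i i' + Real.sqrt (stress D fun _ => (0 : EuclideanSpace ℝ (Fin d))) := by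
  have h : (‖z i - z i'‖ - D i i') ^ 2 ≤ stress D fun _ => (0 : EuclideanSpace ℝ (Fin d)) := by
    -- Minimality is tested against the configuration with all points at the origin; a single term
    -- is at most the whole stress.
    refine le_trans ?_ (hz _)
    unfold stress
    refine le_trans ?_ (Finset.single_le_sum
      (f := fun i => ∑ i', (‖z i - z i'‖ - D i i') ^ 2)
      (fun _ _ => Finset.sum_nonneg fun _ _ => sq_nonneg _) (Finset.mem_univ i))
    exact Finset.single_le_sum (f := fun i' => (‖z i - z i'‖ - D i i') ^ 2)
      (fun _ _ => sq_nonneg _) (Finset.mem_univ i')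
  linarith [Real.le_sqrt_of_sq_le h]

/-- Upper semicontinuity of multidimensional scaling: the dissimilarities that admit a solution
anchored at the origin in a given closed set form a closed set. -/
theorem isClosed_exists_isStressMinimizer {A : Set (Fin (n + 1) → EuclideanSpace ℝ (Fin d))}
    (hA : IsClosed A) :
    IsClosed {D : Fin (n + 1) → Fin (n + 1) → ℝ | ∃ z, IsStressMinimizer D z ∧ z 0 = 0 ∧ z ∈ A} := by
  refine IsSeqClosed.isClosed fun D D₀ hD hlim => ?_
  choose z hz hz0 hzA using hD
  -- Anchoring at the origin turns bounds on distances to point `0` into bounds on norms; these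
  -- bounds converge along the sequence, hence stay bounded, and a subsequence of solutions
  -- converges.
  have hbound : ∀ i, ∃ C, ∀ k, ‖z k i‖ ≤ C := fun i => by
    have hc : Tendsto (fun k => D k i 0 +
        Real.sqrt (stress (D k) fun _ => (0 : EuclideanSpace ℝ (Fin d)))) atTop
        (𝓝 (D₀ i 0 + Real.sqrt (stress D₀ fun _ => (0 : EuclideanSpace ℝ (Fin d))))) := by
      have h1 : Continuous fun D : Fin (n + 1) → Fin (n + 1) → ℝ =>
          D i 0 + Real.sqrt (stress D fun _ => (0 : EuclideanSpace ℝ (Fin d))) :=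
        Continuous.add (by fun_prop) (Real.continuous_sqrt.comp (by unfold stress; fun_prop))
      exact (h1.tendsto D₀).comp hlim
    obtain ⟨C, hC⟩ := hc.bddAbove_range
    refine ⟨C, fun k => le_trans ?_ (hC (Set.mem_range_self k))⟩
    simpa [hz0 k] using (hz k).norm_sub_le i 0
  choose C hC using hbound
  have hmem : ∀ k, z k ∈ Set.univ.pi fun i => Metric.closedBall
      (0 : EuclideanSpace ℝ (Fin d)) (C i) := fun k i _ => by simpa using hC i k
  obtain ⟨a, -, φ, hφ, ha⟩ := tendsto_subseq_of_bounded
    (isCompact_univ_pi fun i => isCompact_closedBall (0 : EuclideanSpace ℝ (Fin d)) (C i)).isBounded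
    hmem
  have hDφ : Tendsto (D ∘ φ) atTop (𝓝 D₀) := hlim.comp hφ.tendsto_atTop
  refine ⟨a, fun z' => ?_, ?_, hA.mem_of_tendsto ha (Eventually.of_forall fun k => hzA _)⟩
  -- For each fixed competitor the minimality inequality passes to the limit by joint continuity of
  -- the stress.
  · refine le_of_tendsto_of_tendsto' ((continuous_stress.tendsto (D₀, a)).comp
      (hDφ.prodMk_nhds ha)) ((continuous_stress.tendsto (D₀, z')).comp
      (hDφ.prodMk_nhds tendsto_const_nhds)) fun k => hz _ z'
  · refine tendsto_nhds_unique ((tendsto_pi_nhds.1 ha) 0) ?_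
    simp [hz0]

/-- The dissimilarities with a solution in which no point is within `ε` of the point `0`. -/
def isolatedDissim (n d : ℕ) (ε : ℝ) : Set (Fin (n + 1) → Fin (n + 1) → ℝ) :=
  {D | ∃ z : Fin (n + 1) → EuclideanSpace ℝ (Fin d), IsStressMinimizer D z ∧
    ∀ i : Fin n, ε ≤ ‖z i.succ - z 0‖}

/-- The dissimilarities with a solution in which the point `i.succ` is within `ε` of the
point `0`. -/
def nearDissim {n : ℕ} (d : ℕ) (ε : ℝ) (i : Fin n) : Set (Fin (n + 1) → Fin (n + 1) → ℝ) :=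
  {D | ∃ z : Fin (n + 1) → EuclideanSpace ℝ (Fin d), IsStressMinimizer D z ∧
    ‖z i.succ - z 0‖ ≤ ε}

/-- The condition involves only differences, so any solution may be translated to the anchored form
that compactness requires. -/
theorem isClosed_isolatedDissim (ε : ℝ) : IsClosed (isolatedDissim n d ε) := by
  have hA : IsClosed {z : Fin (n + 1) → EuclideanSpace ℝ (Fin d) |
      ∀ i : Fin n, ε ≤ ‖z i.succ - z 0‖} := by
    simp only [Set.ofPred_forall]
    exact isClosed_iInter fun i => isClosed_le continuous_const (by fun_prop)
  convert isClosed_exists_isStressMinimizer hA using 1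
  ext D
  constructor
  · rintro ⟨z, hz, h⟩
    exact ⟨_, hz.sub_const (z 0), sub_self _, by simpa using h⟩
  · rintro ⟨z, hz, -, h⟩
    exact ⟨z, hz, h⟩

theorem isClosed_nearDissim (ε : ℝ) (i : Fin n) : IsClosed (nearDissim d ε i) := by
  have hA : IsClosed {z : Fin (n + 1) → EuclideanSpace ℝ (Fin d) | ‖z i.succ - z 0‖ ≤ ε} :=
    isClosed_le (by fun_prop) continuous_const
  convert isClosed_exists_isStressMinimizer hA using 1
  ext D
  constructor
  · rintro ⟨z, hz, h⟩
    exact ⟨_, hz.sub_const (z 0), sub_self _, by simpa using h⟩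
  · rintro ⟨z, hz, -, h⟩
    exact ⟨z, hz, h⟩

end Multidimensional

/-! ### Nearest-neighbour averages. -/

section NearestNeighbour

variable {n d : ℕ}

/-- `i` is a nearest neighbour of the target. -/
def IsNearest (z : Fin (n + 1) → EuclideanSpace ℝ (Fin d)) (i : Fin n) : Prop :=
  ∀ k : Fin n, ‖z i.succ - z 0‖ ≤ ‖z k.succ - z 0‖

theorem isNearest_of_eq_iInf {z : Fin (n + 1) → EuclideanSpace ℝ (Fin d)} {i : Fin n}
    (h : ‖z i.succ - z 0‖ = ⨅ k : Fin n, ‖z k.succ - z 0‖) : IsNearest z i := fun k => by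
  rw [h]
  exact ciInf_le (Set.finite_range _).bddBelow k

/-- A nearest-neighbour prediction lies in every interval that contains the scores of all nearest
neighbours. -/
theorem nnPredict_mem_Icc (hn : 0 < n) {z : Fin (n + 1) → EuclideanSpace ℝ (Fin d)}
    {y : Fin n → ℝ} {a b : ℝ} (h : ∀ i, IsNearest z i → y i ∈ Set.Icc a b) :
    nnPredict z y ∈ Set.Icc a b := by
  classical
  have : Nonempty (Fin n) := ⟨⟨0, hn⟩⟩
  obtain ⟨i₀, hi₀⟩ := exists_eq_ciInf_of_finite (f := fun k : Fin n => ‖z k.succ - z 0‖)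
  set P : Fin n → Prop := fun i => ‖z i.succ - z 0‖ = ⨅ k : Fin n, ‖z k.succ - z 0‖ with hP
  -- With at least one reference the infimum is attained, so the prediction is a genuine average and
  -- not a division by zero.
  have hpos : 0 < ∑ i : Fin n, if P i then (1 : ℝ) else 0 := by
    refine Finset.sum_pos' (fun i _ => by split_ifs <;> norm_num) ⟨i₀, Finset.mem_univ _, ?_⟩
    rw [if_pos hi₀]
    norm_num
  have hval : nnPredict z y =
      (∑ i : Fin n, if P i then y i else 0) / ∑ i : Fin n, if P i then (1 : ℝ) else 0 := by
    simp only [nnPredict, hP]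
  rw [hval, Set.mem_Icc, le_div_iff₀ hpos, div_le_iff₀ hpos, Finset.mul_sum, Finset.mul_sum]
  constructor <;> refine Finset.sum_le_sum fun i _ => ?_ <;> split_ifs with hi <;> simp
  · exact (h i (isNearest_of_eq_iInf hi)).1
  · exact (h i (isNearest_of_eq_iInf hi)).2

end NearestNeighbour

theorem continuous_frobDist_matrix {ι : Type*} {M p : ℕ} (Q : Finset (Fin M)) :
    Continuous fun (A : ι → Fin M → EuclideanSpace ℝ (Fin p)) (i i' : ι) =>
      frobDist Q (A i) (A i') := by
  refine continuous_pi fun i => continuous_pi fun i' => ?_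
  refine Continuous.sqrt (continuous_finsetSum _ fun j _ => ?_)
  have h (i : ι) : Continuous fun A : ι → Fin M → EuclideanSpace ℝ (Fin p) => A i j :=
    continuous_apply_apply i j
  exact ((h i).sub (h i')).norm.pow 2

end DKPS

namespace DKPS

/-! ### Weak law of large numbers for responses. -/

section SampleMean

variable {X : Type*} [MeasurableSpace X] {M p : ℕ}

theorem tendsto_measure_abs_sampleMean_sub {ν : Fin M → Measure X}
    [∀ j, IsProbabilityMeasure (ν j)] (j : Fin M) {g : X → ℝ} (hg : Measurable g)
    (hg2 : MemLp g 2 (ν j)) {δ : ℝ} (hδ : 0 < δ) :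
    Tendsto (fun r : ℕ => Measure.pi (fun jk : Fin M × Fin r => ν jk.1)
      {ω | δ ≤ |(r : ℝ)⁻¹ * ∑ k, g (ω (j, k)) - ∫ x, g x ∂ν j|}) atTop (𝓝 0) := by
  have hlim : Tendsto (fun r : ℕ => ENNReal.ofReal ((r : ℝ)⁻¹ * (Var[g; ν j] / δ ^ 2))) atTop
      (𝓝 0) := by
    have h := (tendsto_inv_atTop_nhds_zero_nat (𝕜 := ℝ)).mul_const (Var[g; ν j] / δ ^ 2)
    rw [zero_mul] at h
    simpa using ENNReal.tendsto_ofReal h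
  refine tendsto_of_tendsto_of_tendsto_of_le_of_le' tendsto_const_nhds hlim
    (Eventually.of_forall fun r => zero_le) ?_
  -- At `r = 0` the bound reads zero and can fail.
  filter_upwards [eventually_gt_atTop 0] with r hr
  have hr' : (r : ℝ) ≠ 0 := by positivity
  set P := Measure.pi (fun jk : Fin M × Fin r => ν jk.1) with hP
  have hmp (k : Fin r) : MeasurePreserving (Function.eval (j, k)) P (ν j) :=
    measurePreserving_eval (fun jk : Fin M × Fin r => ν jk.1) (j, k)
  have hL (k : Fin r) : MemLp (fun ω : Fin M × Fin r → X => g (ω (j, k))) 2 P :=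
    hg2.comp_measurePreserving (hmp k)
  have hS : MemLp (∑ k : Fin r, fun ω : Fin M × Fin r → X => g (ω (j, k))) 2 P :=
    memLp_finsetSum' _ fun k _ => hL k
  have hind : iIndepFun (fun (jk : Fin M × Fin r) (ω : Fin M × Fin r → X) => g (ω jk)) P :=
    iIndepFun_pi (X := fun _ => g) fun _ => hg.aemeasurable
  have hvar : Var[∑ k : Fin r, fun ω : Fin M × Fin r → X => g (ω (j, k)); P] =
      r * Var[g; ν j] := by
    rw [IndepFun.variance_sum (fun k _ => hL k)]
    · rw [Finset.sum_congr rfl fun k _ =>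
        (hmp k).variance_fun_comp (f := g) hg.aemeasurable]
      simp
    · intro k _ k' _ hk
      exact hind.indepFun fun h => hk (Prod.ext_iff.1 h).2
  have hint : ∫ ω, (∑ k : Fin r, fun ω : Fin M × Fin r → X => g (ω (j, k))) ω ∂P =
      r * ∫ x, g x ∂ν j := by
    simp only [Finset.sum_apply]
    rw [integral_finsetSum _ fun k _ => (hL k).integrable (by norm_num)]
    have h (k : Fin r) : ∫ ω, g (ω (j, k)) ∂P = ∫ x, g x ∂ν j := by
      rw [← (hmp k).map_eq, integral_map (hmp k).measurable.aemeasurable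
        hg.aestronglyMeasurable]
    simp [h]
  -- Chebyshev is applied to the unnormalised sum: threshold rδ and variance r Var give Var / (rδ²).
  have hcheb := meas_ge_le_variance_div_sq hS (c := r * δ) (by positivity)
  rw [hint, hvar] at hcheb
  refine (measure_mono fun ω hω => ?_).trans (hcheb.trans (ENNReal.ofReal_le_ofReal ?_))
  · simp only [Set.mem_ofPred_eq, Finset.sum_apply] at hω ⊢
    have : (∑ k : Fin r, g (ω (j, k))) - r * ∫ x, g x ∂ν j =
        r * ((r : ℝ)⁻¹ * ∑ k, g (ω (j, k)) - ∫ x, g x ∂ν j) := by field_simp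
    rw [this, abs_mul, Nat.abs_cast]
    gcongr
  · apply le_of_eq
    field_simp

/-- Weak law of large numbers for the average of the embedded responses to one query. -/
theorem tendsto_measure_norm_sampleMean_sub {ν : Fin M → Measure X}
    [∀ j, IsProbabilityMeasure (ν j)] (j : Fin M) {g : X → EuclideanSpace ℝ (Fin p)}
    (hg : Measurable g) (hg2 : MemLp g 2 (ν j)) {δ : ℝ} (hδ : 0 < δ) :
    Tendsto (fun r : ℕ => Measure.pi (fun jk : Fin M × Fin r => ν jk.1)
      {ω | δ ≤ ‖(r : ℝ)⁻¹ • ∑ k, g (ω (j, k)) - ∫ x, g x ∂ν j‖}) atTop (𝓝 0) := by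
  have hcoord (l : Fin p) : MemLp (fun x => g x l) 2 (ν j) :=
    hg2.of_le (by fun_prop) (Eventually.of_forall fun x => PiLp.norm_apply_le (g x) l)
  -- If all p coordinates deviate by at most δ/(p+1), the squared norm is at most pδ²/(p+1)² < δ²;
  -- the `+ 1` also covers p = 0.
  have hδ' : 0 < δ / (p + 1) := by positivity
  have hsum : Tendsto (fun r : ℕ => ∑ l : Fin p, Measure.pi (fun jk : Fin M × Fin r => ν jk.1)
      {ω | δ / (p + 1) ≤ |(r : ℝ)⁻¹ * ∑ k, g (ω (j, k)) l - ∫ x, g x l ∂ν j|}) atTop (𝓝 0) := by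
    have := tendsto_finsetSum Finset.univ fun (l : Fin p) _ =>
      tendsto_measure_abs_sampleMean_sub j (g := fun x => g x l) (by fun_prop) (hcoord l) hδ'
    simpa using this
  refine tendsto_of_tendsto_of_tendsto_of_le_of_le tendsto_const_nhds hsum (fun r => zero_le)
    fun r => ?_
  refine (measure_mono fun ω hω => ?_).trans (measure_iUnion_fintype_le _ _)
  by_contra hcon
  simp only [Set.mem_iUnion, Set.mem_ofPred_eq, not_exists, not_le] at hcon hω
  set v := (r : ℝ)⁻¹ • ∑ k, g (ω (j, k)) - ∫ x, g x ∂ν j with hv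
  have hvl (l : Fin p) : v l = (r : ℝ)⁻¹ * ∑ k, g (ω (j, k)) l - ∫ x, g x l ∂ν j := by
    rw [hv, PiLp.sub_apply, eval_integral_piLp fun l => (hcoord l).integrable (by norm_num)]
    simp
  have hsq : ‖v‖ ^ 2 ≤ p * (δ / (p + 1)) ^ 2 := by
    rw [EuclideanSpace.norm_sq_eq]
    calc ∑ l, ‖v l‖ ^ 2 ≤ ∑ _l : Fin p, (δ / (p + 1)) ^ 2 := by
          refine Finset.sum_le_sum fun l _ => pow_le_pow_left₀ (norm_nonneg _) ?_ 2
          rw [hvl, Real.norm_eq_abs]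
          exact (hcon l).le
      _ = p * (δ / (p + 1)) ^ 2 := by simp
  have h1 : δ ^ 2 ≤ ‖v‖ ^ 2 := pow_le_pow_left₀ hδ.le hω 2
  have h2 : p * (δ / (p + 1)) ^ 2 < δ ^ 2 := by
    rw [div_pow, mul_div_assoc', div_lt_iff₀ (by positivity)]
    have hp : (p : ℝ) < (p + 1) ^ 2 := by nlinarith [(Nat.cast_nonneg p : (0 : ℝ) ≤ p)]
    rw [mul_comm]
    gcongr
  linarith

end SampleMean

/-! ### Conditioning independent pairs on their first components. -/

section ProductKernel

variable {ι α β : Type*} [Fintype ι] [MeasurableSpace α] [MeasurableSpace β]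

/-- The kernel that applies `κ` independently to each coordinate. -/
noncomputable def coordKernel (ι : Type*) [Fintype ι] (κ : Kernel α β) [IsMarkovKernel κ] :
    Kernel (ι → α) (ι → β) where
  toFun c := Measure.pi fun i => κ (c i)
  measurable' := by
    refine Measurable.measure_of_isPiSystem_of_isProbabilityMeasure generateFrom_pi.symm
      isPiSystem_pi ?_
    rintro _ ⟨s, hs, rfl⟩
    simp only [Measure.pi_pi]
    exact Finset.measurable_prod _ fun i _ =>
      (κ.measurable_coe (hs i (Set.mem_univ i))).comp (measurable_pi_apply i)

variable {κ : Kernel α β} [IsMarkovKernel κ]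

theorem coordKernel_apply (c : ι → α) : coordKernel ι κ c = Measure.pi fun i => κ (c i) := rfl

instance : IsMarkovKernel (coordKernel ι κ) :=
  ⟨fun c => by rw [coordKernel_apply]; infer_instance⟩

theorem lintegral_pi_prod (μ : Measure α) [IsProbabilityMeasure μ] {f : ι → α → ENNReal}
    (hf : ∀ i, Measurable (f i)) :
    ∫⁻ c, ∏ i, f i (c i) ∂(Measure.pi fun _ : ι => μ) = ∏ i, ∫⁻ a, f i a ∂μ := by
  rw [lintegral_prod_eq_prod_lintegral_of_indepFun Finset.univ (fun i (c : ι → α) => f i (c i))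
    (iIndepFun_pi fun i => (hf i).aemeasurable) fun i => (hf i).comp (measurable_pi_apply i)]
  refine Finset.prod_congr rfl fun i _ => ?_
  exact (measurePreserving_eval (fun _ : ι => μ) i).lintegral_comp (hf i)

/-- Independent draws of pairs: first draw all first components, then all second components. -/
theorem pi_compProd_eq_map (μ : Measure α) [IsProbabilityMeasure μ] :
    Measure.pi (fun _ : ι => μ ⊗ₘ κ) =
      (Measure.pi (fun _ : ι => μ) ⊗ₘ coordKernel ι κ).map fun q i => (q.1 i, q.2 i) := by
  refine Measure.pi_eq fun s hs => ?_
  have hmeas : Measurable fun (q : (ι → α) × (ι → β)) i => (q.1 i, q.2 i) := by fun_prop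
  rw [Measure.map_apply hmeas (MeasurableSet.univ_pi hs),
    Measure.compProd_apply (hmeas (MeasurableSet.univ_pi hs))]
  -- The section of a box over `c` is again a box, so its mass factorises and the integral over `c`
  -- splits.
  have h (c : ι → α) : coordKernel ι κ c (Prod.mk c ⁻¹'
      ((fun (q : (ι → α) × (ι → β)) i => (q.1 i, q.2 i)) ⁻¹' Set.univ.pi s)) =
      ∏ i, κ (c i) (Prod.mk (c i) ⁻¹' s i) := by
    rw [coordKernel_apply, ← Measure.pi_pi]
    congr 1
  simp_rw [h]
  rw [lintegral_pi_prod μ fun i => Kernel.measurable_kernel_prodMk_left (hs i)]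
  exact Finset.prod_congr rfl fun i _ => (Measure.compProd_apply (hs i)).symm

/-- The probability of an event about independent draws of pairs. -/
theorem pi_compProd_apply (μ : Measure α) [IsProbabilityMeasure μ] {s : Set (ι → α × β)}
    (hs : MeasurableSet s) :
    Measure.pi (fun _ : ι => μ ⊗ₘ κ) s =
      ∫⁻ c, Measure.pi (fun i => κ (c i)) {x | (fun i => (c i, x i)) ∈ s}
        ∂(Measure.pi fun _ : ι => μ) := by
  have hmeas : Measurable fun (q : (ι → α) × (ι → β)) i => (q.1 i, q.2 i) := by fun_prop
  rw [pi_compProd_eq_map, Measure.map_apply hmeas hs, Measure.compProd_apply (hmeas hs)]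
  rfl

theorem measurable_pi_kernel_section {s : Set (ι → α × β)} (hs : MeasurableSet s) :
    Measurable fun c : ι → α => Measure.pi (fun i => κ (c i)) {x | (fun i => (c i, x i)) ∈ s} := by
  have hmeas : Measurable fun (q : (ι → α) × (ι → β)) i => (q.1 i, q.2 i) := by fun_prop
  exact Kernel.measurable_kernel_prodMk_left (κ := coordKernel ι κ) (hmeas hs)

end ProductKernel

/-- Splitting off the first of `n + 1` independent draws. -/
theorem pi_fin_succ_apply {α : Type*} [MeasurableSpace α] (μ : Measure α) [IsProbabilityMeasure μ]
    {n : ℕ} {s : Set (Fin (n + 1) → α)} (hs : MeasurableSet s) :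
    Measure.pi (fun _ : Fin (n + 1) => μ) s =
      (μ.prod (Measure.pi fun _ : Fin n => μ)) {q | (Fin.cons q.1 q.2 : Fin (n + 1) → α) ∈ s} := by
  have h := (measurePreserving_piFinSuccAbove (fun _ : Fin (n + 1) => μ) 0).symm
  rw [← h.measure_preimage hs.nullMeasurableSet]
  congr 1
  ext q
  simp [MeasurableEquiv.piFinSuccAbove, Fin.insertNthEquiv]

end DKPS

namespace DKPS

/-! ### Isolated collections are rare. -/

namespace Setting

variable {F X : Type*} [MeasurableSpace F] [MeasurableSpace X] {M p : ℕ} (S : Setting F X M p)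

instance (r : ℕ) : IsMarkovKernel (S.responseKernel r) :=
  ⟨fun f => by
    change IsProbabilityMeasure (Measure.pi fun jk : Fin M × Fin r => S.response jk.1 f)
    infer_instance⟩

instance (r : ℕ) : IsProbabilityMeasure (S.drawLaw r) := by
  unfold drawLaw
  infer_instance

instance (n r : ℕ) : IsProbabilityMeasure (S.trainLaw n r) := by
  unfold trainLaw
  infer_instance

theorem measurable_expResponse : Measurable S.expResponse :=
  measurable_pi_lambda _ fun _ =>
    (S.embed_measurable.stronglyMeasurable.integral_kernel).measurable

theorem measurable_popDist {n : ℕ} (Q : Finset (Fin M)) :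
    Measurable fun c : Fin n → F => S.popDist Q c :=
  (continuous_frobDist_matrix Q).measurable.comp
    (measurable_pi_lambda _ fun i => S.measurable_expResponse.comp (measurable_pi_apply i))

/-- The collections (target first) in which, for some choice of true perspectives, no reference
model is within `ε` of the target. -/
def isolatedCollections (d : ℕ) (Q : Finset (Fin M)) (ε : ℝ) (n : ℕ) : Set (Fin (n + 1) → F) :=
  {c | S.popDist Q c ∈ isolatedDissim n d ε}

theorem measurableSet_isolatedCollections (d : ℕ) (Q : Finset (Fin M)) (ε : ℝ) (n : ℕ) :
    MeasurableSet (S.isolatedCollections d Q ε n) :=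
  S.measurable_popDist Q (isClosed_isolatedDissim ε).measurableSet

/-- One reference in the ball would be within ε of the target in every solution, so all must miss
it. The power of n needs a radius that serves collections of every size. -/
theorem measure_isolated_section_le [PseudoMetricSpace F] {d : ℕ} {Q : Finset (Fin M)}
    {ε : ℝ} {f : F} {δ : ℝ} (hδ : ∀ f' : F, dist f f' < δ →
      ∀ (n : ℕ) (c : Fin n → F) (ψ : Fin n → EuclideanSpace ℝ (Fin d)),
        S.IsTruePerspective Q c ψ → ∀ i i', c i = f → c i' = f' → ‖ψ i - ψ i'‖ < ε) (n : ℕ) :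
    Measure.pi (fun _ : Fin n => S.modelLaw)
        {c | (Fin.cons f c : Fin (n + 1) → F) ∈ S.isolatedCollections d Q ε n} ≤
      S.modelLaw (Metric.ball f δ)ᶜ ^ n := by
  have hpi := Measure.pi_pi (fun _ : Fin n => S.modelLaw) fun _ => (Metric.ball f δ)ᶜ
  rw [Finset.prod_const, Finset.card_univ, Fintype.card_fin] at hpi
  rw [← hpi]
  refine measure_mono ?_
  rintro c ⟨ψ, hψ, hfar⟩ i -
  intro hi
  refine absurd (hfar i) (not_le.2 ?_)
  rw [norm_sub_rev]
  exact hδ (c i) (by rwa [dist_comm]) (n + 1) _ ψ hψ 0 i.succ rfl rfl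

/-- A random collection of many models has a reference model close to the target. -/
theorem tendsto_measure_isolatedCollections [PseudoMetricSpace F] [OpensMeasurableSpace F]
    (hsupp : S.FullSupport) {d : ℕ} {Q : Finset (Fin M)} (hQ : S.PerspectiveContinuous d Q)
    {ε : ℝ} (hε : 0 < ε) :
    Tendsto (fun n => Measure.pi (fun _ : Fin (n + 1) => S.modelLaw)
      (S.isolatedCollections d Q ε n)) atTop (𝓝 0) := by
  have hmeas (n : ℕ) : MeasurableSet {q : F × (Fin n → F) |
      (Fin.cons q.1 q.2 : Fin (n + 1) → F) ∈ S.isolatedCollections d Q ε n} := by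
    refine (S.measurableSet_isolatedCollections d Q ε n).preimage
      (measurable_pi_lambda _ fun i => ?_)
    refine Fin.cases ?_ (fun i => ?_) i
    · exact measurable_fst
    · exact (measurable_pi_apply i).comp measurable_snd
  have heq (n : ℕ) : Measure.pi (fun _ : Fin (n + 1) => S.modelLaw)
      (S.isolatedCollections d Q ε n) = ∫⁻ f, Measure.pi (fun _ : Fin n => S.modelLaw)
        {c | (Fin.cons f c : Fin (n + 1) → F) ∈ S.isolatedCollections d Q ε n} ∂S.modelLaw := by
    rw [pi_fin_succ_apply _ (S.measurableSet_isolatedCollections d Q ε n),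
      Measure.prod_apply (hmeas n)]
    rfl
  simp_rw [heq]
  rw [← lintegral_zero (μ := S.modelLaw)]
  -- The radius and the mass of the ball depend on the target, so convergence is only pointwise in
  -- `f`.
  refine tendsto_lintegral_of_dominated_convergence (fun _ => 1)
    (fun n => measurable_measure_prodMk_left (hmeas n))
    (fun n => Eventually.of_forall fun f => prob_le_one) (by simp) (Eventually.of_forall fun f => ?_)
  obtain ⟨δ, hδ, h⟩ := hQ f ε hε
  refine tendsto_of_tendsto_of_tendsto_of_le_of_le tendsto_const_nhds
    (ENNReal.tendsto_pow_atTop_nhds_zero_of_lt_one ?_) (fun _ => zero_le)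
    fun n => S.measure_isolated_section_le h n
  obtain ⟨ρ, hρ, hball⟩ := hsupp f δ hδ
  rw [prob_compl_eq_one_sub Metric.isOpen_ball.measurableSet]
  refine ENNReal.sub_lt_self ENNReal.one_ne_top one_ne_zero fun h0 => ?_
  rw [measureReal_def, h0, ENNReal.toReal_zero] at hball
  linarith

/-! ### Misleading data are rare. -/

variable {d : ℕ} (psiHat : Finset (Fin M) → ∀ n r : ℕ,
    (Fin n → Draw F X M r) → Fin n → EuclideanSpace ℝ (Fin d))

/-- The data (target first) for which some nearest neighbour of the target has a score that differs
from the target's by more than `τ`. -/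
def misleadingData (Q : Finset (Fin M)) (τ : ℝ) (n r : ℕ) : Set (Fin (n + 1) → Draw F X M r) :=
  {x | ∃ i : Fin n, IsNearest (psiHat Q (n + 1) r x) i ∧
    τ < |S.score (x i.succ).1 Finset.univ - S.score (x 0).1 Finset.univ|}

variable {psiHat}

theorem measurableSet_misleadingData (hpsi : S.IsDKPS psiHat) (Q : Finset (Fin M)) (τ : ℝ)
    (n r : ℕ) : MeasurableSet (S.misleadingData psiHat Q τ n r) := by
  have hz (i : Fin (n + 1)) : Measurable fun x => psiHat Q (n + 1) r x i :=
    (measurable_pi_apply i).comp (hpsi Q (n + 1) r).1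
  have hy (i : Fin (n + 1)) : Measurable fun x : Fin (n + 1) → Draw F X M r =>
      S.score (x i).1 Finset.univ :=
    (S.score_measurable _).comp (measurable_fst.comp (measurable_pi_apply i))
  have : S.misleadingData psiHat Q τ n r = ⋃ i : Fin n,
      (⋂ k : Fin n, {x | ‖psiHat Q (n + 1) r x i.succ - psiHat Q (n + 1) r x 0‖ ≤
        ‖psiHat Q (n + 1) r x k.succ - psiHat Q (n + 1) r x 0‖}) ∩
      {x | τ < |S.score (x i.succ).1 Finset.univ - S.score (x 0).1 Finset.univ|} := by
    ext x
    simp [misleadingData, IsNearest]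
  rw [this]
  refine MeasurableSet.iUnion fun i => (MeasurableSet.iInter fun k => ?_).inter ?_
  · exact measurableSet_le ((hz _).sub (hz _)).norm ((hz _).sub (hz _)).norm
  · exact measurableSet_lt measurable_const ((hy _).sub (hy _)).abs

/-- Data whose average responses are close to the expected ones are not misleading, if the
collection is not isolated. -/
theorem exists_forall_notMem_misleadingData (hpsi : S.IsDKPS psiHat) {Q : Finset (Fin M)} {γ : ℝ}
    (hγ : 0 < γ) (hlip : ∀ (n : ℕ) (c : Fin n → F) (ψ : Fin n → EuclideanSpace ℝ (Fin d)),
      S.IsTruePerspective Q c ψ → ∀ i i',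
        |S.score (c i) Finset.univ - S.score (c i') Finset.univ| ≤ γ * ‖ψ i - ψ i'‖)
    {ε : ℝ} {n : ℕ} {c : Fin (n + 1) → F} (hc : c ∉ S.isolatedCollections d Q ε n) :
    ∃ δ : ℝ, 0 < δ ∧ ∀ (r : ℕ) (x : Fin (n + 1) → Draw F X M r), (∀ i, (x i).1 = c i) →
      (∀ i j, ‖S.meanResponse (x i) j - S.expResponse (c i) j‖ < δ) →
        x ∉ S.misleadingData psiHat Q (γ * ε) n r := by
  -- The second condition constrains only references with a bad score; the finite intersection keeps
  -- `G` open.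
  set G : Set (Fin (n + 1) → Fin (n + 1) → ℝ) := (isolatedDissim n d ε)ᶜ ∩
    ⋂ i : Fin n, {D | γ * ε < |S.score (c i.succ) Finset.univ - S.score (c 0) Finset.univ| →
      D ∉ nearDissim d ε i} with hG
  have hGopen : IsOpen G := by
    refine (isClosed_isolatedDissim ε).isOpen_compl.inter (isOpen_iInter_of_finite fun i => ?_)
    by_cases h : γ * ε < |S.score (c i.succ) Finset.univ - S.score (c 0) Finset.univ|
    · simp only [h, forall_const]
      exact (isClosed_nearDissim ε i).isOpen_compl
    · simp [h]
  have hcG : S.popDist Q c ∈ G := by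
    refine ⟨hc, Set.mem_iInter.2 fun i => ?_⟩
    rintro hlt ⟨ψ, hψ, hle⟩
    exact absurd (hlt.trans_le (hlip _ c ψ hψ i.succ 0))
      (not_lt.2 (mul_le_mul_of_nonneg_left hle hγ.le))
  have hpre := (hGopen.preimage (continuous_frobDist_matrix (ι := Fin (n + 1)) (p := p) Q))
  obtain ⟨δ, hδ, hball⟩ := Metric.isOpen_iff.1 hpre (fun i => S.expResponse (c i)) hcG
  refine ⟨δ, hδ, fun r x hx hclose => ?_⟩
  have hxG : S.estDist Q x ∈ G := by
    refine hball (a := fun i => S.meanResponse (x i)) ?_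
    rw [Metric.mem_ball, dist_pi_lt_iff hδ]
    intro i
    rw [dist_pi_lt_iff hδ]
    intro j
    rw [dist_eq_norm]
    exact hclose i j
  rintro ⟨i, hnear, hfar⟩
  rw [hx, hx] at hfar
  have hmin := (hpsi Q (n + 1) r).2 x
  refine Set.mem_iInter.1 hxG.2 i hfar ⟨_, hmin, ?_⟩
  -- A nearest neighbour farther than ε would put every reference beyond ε, making this solution
  -- isolated.
  by_contra! hlt
  exact hxG.1 ⟨_, hmin, fun k => hlt.le.trans (hnear k)⟩

/-- Given the models of a collection that is not isolated, the responses are misleading with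
vanishing probability. -/
theorem tendsto_measure_misleadingData_section (hmom : S.FiniteSecondMoment)
    (hpsi : S.IsDKPS psiHat) {Q : Finset (Fin M)} {γ : ℝ}
    (hγ : 0 < γ) (hlip : ∀ (n : ℕ) (c : Fin n → F) (ψ : Fin n → EuclideanSpace ℝ (Fin d)),
      S.IsTruePerspective Q c ψ → ∀ i i',
        |S.score (c i) Finset.univ - S.score (c i') Finset.univ| ≤ γ * ‖ψ i - ψ i'‖)
    {ε : ℝ} {n : ℕ} {c : Fin (n + 1) → F} (hc : c ∉ S.isolatedCollections d Q ε n) :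
    Tendsto (fun r => Measure.pi (fun i => S.responseKernel r (c i))
      {x | (fun i => (c i, x i)) ∈ S.misleadingData psiHat Q (γ * ε) n r}) atTop (𝓝 0) := by
  obtain ⟨δ, hδ, h⟩ := S.exists_forall_notMem_misleadingData hpsi hγ hlip hc
  have hsum : Tendsto (fun r : ℕ => ∑ i : Fin (n + 1), ∑ j : Fin M, S.responseKernel r (c i)
      {ω | δ ≤ ‖S.meanResponse (c i, ω) j - S.expResponse (c i) j‖}) atTop (𝓝 0) := by
    have := tendsto_finsetSum Finset.univ fun (i : Fin (n + 1)) _ =>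
      tendsto_finsetSum Finset.univ fun (j : Fin M) _ =>
        tendsto_measure_norm_sampleMean_sub (ν := fun j => S.response j (c i)) j
          S.embed_measurable (hmom (c i) j) hδ
    simp only [Finset.sum_const_zero] at this
    exact this
  refine tendsto_of_tendsto_of_tendsto_of_le_of_le tendsto_const_nhds hsum (fun r => zero_le)
    fun r => ?_
  calc Measure.pi (fun i => S.responseKernel r (c i))
        {x | (fun i => (c i, x i)) ∈ S.misleadingData psiHat Q (γ * ε) n r}
      ≤ Measure.pi (fun i => S.responseKernel r (c i)) (⋃ i : Fin (n + 1), ⋃ j : Fin M,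
        Function.eval i ⁻¹' {ω | δ ≤ ‖S.meanResponse (c i, ω) j - S.expResponse (c i) j‖}) := by
        refine measure_mono fun x hx => ?_
        by_contra hcon
        simp only [Set.mem_iUnion, Set.mem_preimage, Set.mem_ofPred_eq, not_exists, not_le,
          Function.eval] at hcon
        exact h r _ (fun i => rfl) hcon hx
    _ ≤ ∑ i : Fin (n + 1), ∑ j : Fin M, Measure.pi (fun i => S.responseKernel r (c i))
        (Function.eval i ⁻¹' {ω | δ ≤ ‖S.meanResponse (c i, ω) j - S.expResponse (c i) j‖}) :=
        (measure_iUnion_fintype_le _ _).trans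
          (Finset.sum_le_sum fun i _ => measure_iUnion_fintype_le _ _)
    _ = _ := by
        refine Finset.sum_congr rfl fun i _ => Finset.sum_congr rfl fun j _ => ?_
        refine (measurePreserving_eval (fun i => S.responseKernel r (c i)) i).measure_preimage
          (MeasurableSet.nullMeasurableSet (measurableSet_le measurable_const ?_))
        refine Measurable.norm (Measurable.sub_const ?_ _)
        have hk (k : Fin r) : Measurable fun ω : Fin M × Fin r → X => S.embed (ω (j, k)) :=
          S.embed_measurable.comp (measurable_pi_apply (j, k))
        exact (Finset.measurable_fun_sum Finset.univ fun k _ => hk k).const_smul (r : ℝ)⁻¹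

/-- For a fixed number of models, misleading data is eventually (as the number of responses grows)
at most slightly more probable than an isolated collection. -/
theorem eventually_measure_misleadingData_le (hmom : S.FiniteSecondMoment)
    (hpsi : S.IsDKPS psiHat) {Q : Finset (Fin M)} {γ : ℝ}
    (hγ : 0 < γ) (hlip : ∀ (n : ℕ) (c : Fin n → F) (ψ : Fin n → EuclideanSpace ℝ (Fin d)),
      S.IsTruePerspective Q c ψ → ∀ i i',
        |S.score (c i) Finset.univ - S.score (c i') Finset.univ| ≤ γ * ‖ψ i - ψ i'‖)
    (ε : ℝ) (n : ℕ) {κ : ENNReal} (hκ : 0 < κ) :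
    ∀ᶠ r in atTop, Measure.pi (fun _ : Fin (n + 1) => S.drawLaw r)
      (S.misleadingData psiHat Q (γ * ε) n r) ≤
        Measure.pi (fun _ : Fin (n + 1) => S.modelLaw) (S.isolatedCollections d Q ε n) + κ := by
  set B := S.isolatedCollections d Q ε n
  have hB : MeasurableSet B := S.measurableSet_isolatedCollections d Q ε n
  set g : ℕ → (Fin (n + 1) → F) → ENNReal := fun r c =>
    Measure.pi (fun i => S.responseKernel r (c i))
      {x | (fun i => (c i, x i)) ∈ S.misleadingData psiHat Q (γ * ε) n r} with hg
  have hgm (r : ℕ) : Measurable (g r) :=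
    measurable_pi_kernel_section (S.measurableSet_misleadingData hpsi Q (γ * ε) n r)
  have hg1 (r : ℕ) (c : Fin (n + 1) → F) : g r c ≤ 1 := prob_le_one
  -- The sampling error vanishes only off `B`, without a uniform rate; on `B` the trivial bound 1
  -- yields the measure of `B`.
  have hlim : Tendsto (fun r => ∫⁻ c, Bᶜ.indicator (g r) c
      ∂(Measure.pi fun _ : Fin (n + 1) => S.modelLaw)) atTop (𝓝 0) := by
    rw [← lintegral_zero (μ := Measure.pi fun _ : Fin (n + 1) => S.modelLaw)]
    refine tendsto_lintegral_of_dominated_convergence (fun _ => 1)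
      (fun r => (hgm r).indicator hB.compl)
      (fun r => Eventually.of_forall fun c => (Set.indicator_le_self _ _ c).trans (hg1 r c))
      (by simp) (Eventually.of_forall fun c => ?_)
    by_cases hc : c ∈ B
    · simp [hc]
    · simpa [hc] using S.tendsto_measure_misleadingData_section hmom hpsi hγ hlip hc
  filter_upwards [hlim.eventually_le_const hκ] with r hr
  have hdraw : Measure.pi (fun _ : Fin (n + 1) => S.drawLaw r)
      (S.misleadingData psiHat Q (γ * ε) n r) =
      ∫⁻ c, g r c ∂(Measure.pi fun _ : Fin (n + 1) => S.modelLaw) :=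
    pi_compProd_apply S.modelLaw (S.measurableSet_misleadingData hpsi Q (γ * ε) n r)
  rw [hdraw]
  calc ∫⁻ c, g r c ∂(Measure.pi fun _ : Fin (n + 1) => S.modelLaw)
      ≤ ∫⁻ c, B.indicator 1 c + Bᶜ.indicator (g r) c
          ∂(Measure.pi fun _ : Fin (n + 1) => S.modelLaw) := by
        refine lintegral_mono fun c => ?_
        by_cases hc : c ∈ B
        · simpa [hc] using hg1 r c
        · simp [hc]
    _ ≤ _ := by
        rw [lintegral_add_left (measurable_one.indicator hB), lintegral_indicator_one hB]
        gcongr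

/-! ### From misleading data to the risk. -/

theorem sqLoss_nnPredictor_le {Q : Finset (Fin M)} {τ : ℝ} {n r : ℕ} (hn : 0 < n)
    (s : Fin n → Draw F X M r) (t : Draw F X M r) :
    sqLoss (S.nnPredictor psiHat Q n r s t) (S.score t.1 Finset.univ) ≤ τ ^ 2 +
      {t | (Fin.cons t s : Fin (n + 1) → Draw F X M r) ∈
        S.misleadingData psiHat Q τ n r}.indicator (fun _ => (1 : ℝ)) t := by
  -- On misleading data prediction and score both lie in [0,1], so the loss is at most 1; otherwise
  -- all averaged scores are within τ of the target's.
  by_cases h : (Fin.cons t s : Fin (n + 1) → Draw F X M r) ∈ S.misleadingData psiHat Q τ n r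
  · have h1 : S.nnPredictor psiHat Q n r s t ∈ Set.Icc (0 : ℝ) 1 :=
      nnPredict_mem_Icc hn fun i _ => S.score_mem _ _
    have h2 := S.score_mem t.1 Finset.univ
    rw [Set.indicator_of_mem (by exact h), sqLoss]
    nlinarith [h1.1, h1.2, h2.1, h2.2, sq_nonneg τ]
  · rw [Set.indicator_of_notMem (by exact h), add_zero, sqLoss]
    have h1 : S.nnPredictor psiHat Q n r s t ∈
        Set.Icc (S.score t.1 Finset.univ - τ) (S.score t.1 Finset.univ + τ) := by
      refine nnPredict_mem_Icc hn fun i hi => ?_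
      have h3 : |S.score (s i).1 Finset.univ - S.score t.1 Finset.univ| ≤ τ := by
        by_contra! hlt
        exact h ⟨i, hi, by simpa using hlt⟩
      rw [abs_le] at h3
      constructor <;> linarith
    rw [← sq_abs]
    refine pow_le_pow_left₀ (abs_nonneg _) (abs_le.2 ⟨?_, ?_⟩) 2 <;> linarith [h1.1, h1.2]

theorem measurableSet_cons_misleadingData (hpsi : S.IsDKPS psiHat) (Q : Finset (Fin M)) (τ : ℝ)
    (n r : ℕ) : MeasurableSet {q : (Fin n → Draw F X M r) × Draw F X M r |
      (Fin.cons q.2 q.1 : Fin (n + 1) → Draw F X M r) ∈ S.misleadingData psiHat Q τ n r} := by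
  refine (S.measurableSet_misleadingData hpsi Q τ n r).preimage
    (measurable_pi_lambda _ fun i => ?_)
  refine Fin.cases ?_ (fun i => ?_) i
  · exact measurable_snd
  · exact (measurable_pi_apply i).comp measurable_fst

theorem risk_nnPredictor_le (hpsi : S.IsDKPS psiHat) {Q : Finset (Fin M)} (τ : ℝ) {n r : ℕ}
    (hn : 0 < n) (s : Fin n → Draw F X M r) :
    S.risk sqLoss (S.nnPredictor psiHat Q) s ≤ τ ^ 2 + (S.drawLaw r).real
      {t | (Fin.cons t s : Fin (n + 1) → Draw F X M r) ∈ S.misleadingData psiHat Q τ n r} := by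
  have hm : MeasurableSet {t | (Fin.cons t s : Fin (n + 1) → Draw F X M r) ∈
      S.misleadingData psiHat Q τ n r} :=
    measurable_prodMk_left (x := s) (S.measurableSet_cons_misleadingData hpsi Q τ n r)
  have hi := (integrable_const (1 : ℝ) (μ := S.drawLaw r)).indicator hm
  -- Only the upper bound must be integrable, so measurability of the loss is not needed.
  refine (integral_mono_of_nonneg (Eventually.of_forall fun t => sq_nonneg _)
    ((integrable_const (τ ^ 2)).add hi)
    (Eventually.of_forall fun t => S.sqLoss_nnPredictor_le hn s t)).trans_eq ?_
  simp only [Pi.add_apply]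
  rw [integral_add (integrable_const _) hi, integral_indicator_const _ hm]
  simp

/-- Markov's inequality for the risk of nearest-neighbour regression. -/
theorem measure_risk_nnPredictor_gt_le (hpsi : S.IsDKPS psiHat) {Q : Finset (Fin M)} {τ ε : ℝ}
    (hτ : τ ^ 2 < ε) {n r : ℕ} (hn : 0 < n) :
    S.trainLaw n r {s | ¬ S.risk sqLoss (S.nnPredictor psiHat Q) s ≤ ε} ≤
      Measure.pi (fun _ : Fin (n + 1) => S.drawLaw r) (S.misleadingData psiHat Q τ n r) /
        ENNReal.ofReal (ε - τ ^ 2) := by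
  have hm := S.measurableSet_cons_misleadingData hpsi Q τ n r
  have hm' : MeasurableSet {q : Draw F X M r × (Fin n → Draw F X M r) |
      (Fin.cons q.1 q.2 : Fin (n + 1) → Draw F X M r) ∈ S.misleadingData psiHat Q τ n r} :=
    measurable_swap hm
  have hpi : Measure.pi (fun _ : Fin (n + 1) => S.drawLaw r) (S.misleadingData psiHat Q τ n r) =
      ∫⁻ s, S.drawLaw r {t | (Fin.cons t s : Fin (n + 1) → Draw F X M r) ∈
        S.misleadingData psiHat Q τ n r} ∂(S.trainLaw n r) := by
    rw [pi_fin_succ_apply _ (S.measurableSet_misleadingData hpsi Q τ n r),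
      Measure.prod_apply_symm hm']
    rfl
  rw [hpi]
  refine (measure_mono fun s hs => ?_).trans (meas_ge_le_lintegral_div
    (measurable_measure_prodMk_left hm).aemeasurable (by simpa using hτ) ENNReal.ofReal_ne_top)
  have h := S.risk_nnPredictor_le hpsi (Q := Q) τ hn s
  rw [Set.mem_ofPred_eq, not_le] at hs
  refine ENNReal.ofReal_le_of_le_toReal (le_of_lt ?_)
  change _ < (S.drawLaw r).real _
  refine lt_of_lt_of_le ?_ (sub_le_iff_le_add'.2 h)
  linarith

theorem withHighProbability_risk_nnPredictor_le [PseudoMetricSpace F] [OpensMeasurableSpace F]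
    (hmom : S.FiniteSecondMoment) (hsupp : S.FullSupport) (hpsi : S.IsDKPS psiHat)
    {Q : Finset (Fin M)} (hlip : S.LipschitzScore d Q) (hcont : S.PerspectiveContinuous d Q)
    {ε : ℝ} (hε : 0 < ε) :
    S.WithHighProbability fun _ _ s => S.risk sqLoss (S.nnPredictor psiHat Q) s ≤ ε := by
  intro η hη
  obtain ⟨γ, hγ, hlip⟩ := hlip
  -- Half of ε pays for τ²; the other half is the threshold in Markov's inequality. The perspective
  -- radius is τ/γ, so that the score tolerance is τ.
  set τ := Real.sqrt (ε / 2) with hτdef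
  have hτ2 : τ ^ 2 = ε / 2 := Real.sq_sqrt (by positivity)
  have hτ : 0 < τ := Real.sqrt_pos.2 (by positivity)
  -- Isolation and sampling each get half of η · ε/2, which Markov's inequality divides by ε/2.
  have hκ : 0 < ENNReal.ofReal (η * (ε / 2) / 2) := ENNReal.ofReal_pos.2 (by positivity)
  obtain ⟨N, hN⟩ := eventually_atTop.1 ((S.tendsto_measure_isolatedCollections hsupp hcont
    (div_pos hτ hγ)).eventually_le_const hκ)
  refine ⟨N, fun n hn => ?_⟩
  obtain ⟨R, hR⟩ := eventually_atTop.1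
    (S.eventually_measure_misleadingData_le hmom hpsi hγ hlip (τ / γ) n hκ)
  refine ⟨R, fun r hr => ?_⟩
  have hbad := (hR r hr).trans (add_le_add_left (hN n hn.le) _)
  rw [mul_div_cancel₀ τ hγ.ne', ← ENNReal.ofReal_add (by positivity) (by positivity),
    add_halves] at hbad
  have hmarkov := S.measure_risk_nnPredictor_gt_le hpsi (Q := Q) (τ := τ) (ε := ε) (r := r)
    (by linarith) (Nat.zero_lt_of_lt hn)
  refine ENNReal.toReal_le_of_le_ofReal hη.le (hmarkov.trans ?_)
  rw [show ε - τ ^ 2 = ε / 2 by linarith]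
  refine ENNReal.div_le_of_le_mul ?_
  rwa [← ENNReal.ofReal_mul hη.le]

theorem risk_subsetPredictor (Q : Finset (Fin M)) {n r : ℕ} (s : Fin n → Draw F X M r) :
    S.risk sqLoss (S.subsetPredictor Q) s = S.subsetMSE Q := by
  have h : (S.drawLaw r).map Prod.fst = S.modelLaw := Measure.fst_compProd _ _
  rw [subsetMSE, ← h, integral_map measurable_fst.aemeasurable]
  · rfl
  · exact (((S.score_measurable Q).sub (S.score_measurable _)).pow_const 2).aestronglyMeasurable

/-- The risk of the subset score is a constant, independent of n, r and the reference data, so it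
can itself serve as ε. -/
theorem qEfficient_nnPredictor [PseudoMetricSpace F] [OpensMeasurableSpace F]
    (hmom : S.FiniteSecondMoment) (hsupp : S.FullSupport) (hpsi : S.IsDKPS psiHat)
    {Q : Finset (Fin M)} (hlip : S.LipschitzScore d Q) (hcont : S.PerspectiveContinuous d Q)
    (hmse : 0 < S.subsetMSE Q) :
    S.QEfficient sqLoss (S.nnPredictor psiHat Q) (S.subsetPredictor Q) := by
  simp only [QEfficient, risk_subsetPredictor]
  exact S.withHighProbability_risk_nnPredictor_le hmom hsupp hpsi hlip hcont hmse

end Setting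

end DKPS

theorem theorem2 {F X : Type*} [PseudoMetricSpace F] [MeasurableSpace F] [OpensMeasurableSpace F]
    [MeasurableSpace X] {M p d : ℕ} (S : DKPS.Setting F X M p)
    (hmom : S.FiniteSecondMoment) (hsupp : S.FullSupport)
    (psiHat : Finset (Fin M) → ∀ n r : ℕ,
      (Fin n → DKPS.Draw F X M r) → Fin n → EuclideanSpace ℝ (Fin d))
    (hpsi : S.IsDKPS psiHat) :
    (∀ Q : Finset (Fin M), S.LipschitzScore d Q → S.PerspectiveContinuous d Q →
      ∀ ε : ℝ, 0 < ε →
        S.WithHighProbability fun _ _ s =>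
          S.risk DKPS.sqLoss (S.nnPredictor psiHat Q) s ≤ ε) ∧
    (∀ Q : Finset (Fin M), S.LipschitzScore d Q → S.PerspectiveContinuous d Q →
      0 < S.subsetMSE Q →
        S.QEfficient DKPS.sqLoss (S.nnPredictor psiHat Q) (S.subsetPredictor Q)) ∧
    (∀ m : ℕ, m < M →
      (∀ Q : Finset (Fin M), Q.card = m →
        S.LipschitzScore d Q ∧ S.PerspectiveContinuous d Q ∧ 0 < S.subsetMSE Q) →
      S.MEfficient DKPS.sqLoss m (S.nnPredictor psiHat) S.subsetPredictor) ∧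
    ((∀ Q : Finset (Fin M), 1 ≤ Q.card → Q.card < M →
        S.LipschitzScore d Q ∧ S.PerspectiveContinuous d Q ∧ 0 < S.subsetMSE Q) →
      S.QueryEfficient DKPS.sqLoss (S.nnPredictor psiHat) S.subsetPredictor) := by
  refine ⟨fun Q hlip hcont ε hε =>
      S.withHighProbability_risk_nnPredictor_le hmom hsupp hpsi hlip hcont hε,
    fun Q hlip hcont hmse => S.qEfficient_nnPredictor hmom hsupp hpsi hlip hcont hmse,
    fun m _ h Q hQ => ?_, fun h m hm hmM Q hQ => ?_⟩
  · obtain ⟨hlip, hcont, hmse⟩ := h Q hQ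
    exact S.qEfficient_nnPredictor hmom hsupp hpsi hlip hcont hmse
  · obtain ⟨hlip, hcont, hmse⟩ := h Q (hQ ▸ hm) (hQ ▸ hmM)
    exact S.qEfficient_nnPredictor hmom hsupp hpsi hlip hcont hmse
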